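/- Let $H$ be a separable complex Hilbert space, let $m\ge 1$ be an integer, and let $\{T(t)\}_{t\ge 0}$ be a $C_0$-semigroup of bounded linear operators on $H$ (that is, $T(0)=I$, $T(s+t)=T(t)T(s)$ for all $s,t\ge 0$, and $\lim_{t\to 0^+}T(t)x=x$ for every $x\in H$) with infinitesimal generator $A$, where $Ax=\lim_{t\to0^+}\frac{T(t)x-x}{t}$ and $D(A)$ is the set of all $x\in H$ for which this limit exists. For an integer $n\ge 0$, a bounded linear operator $S$ on $H$ is called an $n$-isometry if $$\sum_{k=0}^{n}\binom{n}{k}(-1)^{n-k}\|S^kx\|^2=0\qquad\text{for every }x\in H,$$ and $S$ is called a strict $m$-isometry if it is an $m$-isometry but not an $(m-1)$-isometry. (An operator is a $0$-isometry only if $H=\{0\}$.) If $1$ belongs to the resolvent set of $A$, the cogenerator of the semigroup is the bounded operator $V=(A+I)(A-I)^{-1}$; otherwise the cogenerator does not exist. Then $T(t)$ is a strict $m$-isometry for every $t>0$ if and only if the cogenerator $V$ of $\{T(t)\}_{t\ge 0}$ exists and is a strict $m$-isometry. -/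

import Mathlib

open Filter Topology
open scoped NNReal

/-- `T` is an `m`-isometry: `∑_{k=0}^m (m choose k) (-1)^{m-k} ‖T^k x‖² = 0` for every `x`.
For `m = 0` the condition reads `‖x‖² = 0` for every `x`, i.e. the space is zero. -/
def IsMIsometry {H : Type*} [NormedAddCommGroup H] [InnerProductSpace ℂ H]
    (m : ℕ) (T : H →L[ℂ] H) : Prop :=
  ∀ x : H, ∑ k ∈ Finset.range (m + 1),
    (m.choose k : ℝ) * (-1) ^ (m - k) * ‖(T ^ k) x‖ ^ 2 = 0

/-- `T` is a strict `m`-isometry (`1 ≤ m`): an `m`-isometry that is not an `(m-1)`-isometry. -/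
def IsStrictMIsometry {H : Type*} [NormedAddCommGroup H] [InnerProductSpace ℂ H]
    (m : ℕ) (T : H →L[ℂ] H) : Prop :=
  IsMIsometry m T ∧ ¬ IsMIsometry (m - 1) T

/-- A `C₀`-semigroup of bounded linear operators on `H`. -/
structure C0Semigroup (H : Type*) [NormedAddCommGroup H] [InnerProductSpace ℂ H] where
  op : ℝ≥0 → H →L[ℂ] H
  op_zero : op 0 = 1
  op_add : ∀ s t : ℝ≥0, op (s + t) = op t * op s
  tendsto_op : ∀ x : H, Tendsto (fun t : ℝ≥0 => op t x) (𝓝[>] 0) (𝓝 x)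

namespace C0Semigroup

variable {H : Type*} [NormedAddCommGroup H] [InnerProductSpace ℂ H]

/-- The difference quotient of the orbit of `x` at `0` converges to `y` as `t → 0⁺`. -/
def HasGenValue (T : C0Semigroup H) (x y : H) : Prop :=
  Tendsto (fun t : ℝ≥0 => ((t : ℝ) : ℂ)⁻¹ • (T.op t x - x)) (𝓝[>] 0) (𝓝 y)

theorem HasGenValue.unique {T : C0Semigroup H} {x y z : H}
    (hy : T.HasGenValue x y) (hz : T.HasGenValue x z) : y = z :=
  tendsto_nhds_unique hy hz

theorem HasGenValue.add {T : C0Semigroup H} {x x' y y' : H}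
    (h : T.HasGenValue x y) (h' : T.HasGenValue x' y') : T.HasGenValue (x + x') (y + y') := by
  refine (Tendsto.add h h').congr fun t => ?_
  rw [← smul_add, map_add]
  congr 1
  abel

theorem HasGenValue.smul {T : C0Semigroup H} {x y : H} (c : ℂ)
    (h : T.HasGenValue x y) : T.HasGenValue (c • x) (c • y) := by
  refine (Tendsto.const_smul h c).congr fun t => ?_
  rw [smul_comm, smul_sub, map_smul]

theorem hasGenValue_zero (T : C0Semigroup H) : T.HasGenValue 0 0 := by
  simp [HasGenValue]

/-- The infinitesimal generator of a `C₀`-semigroup, as a partially defined linear operator. Its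
domain consists of all `x` for which `lim_{t → 0⁺} (T(t) x - x) / t` exists, and its value at
such an `x` is this limit. -/
noncomputable def generator (T : C0Semigroup H) : H →ₗ.[ℂ] H where
  domain :=
    { carrier := {x | ∃ y, T.HasGenValue x y}
      add_mem' := fun ⟨_, h⟩ ⟨_, h'⟩ => ⟨_, h.add h'⟩
      zero_mem' := ⟨0, T.hasGenValue_zero⟩
      smul_mem' := fun c _ ⟨_, h⟩ => ⟨_, h.smul c⟩ }
  toFun :=
    { toFun := fun x => Classical.choose x.2
      map_add' := fun x x' => (Classical.choose_spec (x + x').2).unique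
        ((Classical.choose_spec x.2).add (Classical.choose_spec x'.2))
      map_smul' := fun c x => (Classical.choose_spec (c • x).2).unique
        ((Classical.choose_spec x.2).smul c) }

/-- Checks that the generator is the stated limit. -/
theorem generator_spec (T : C0Semigroup H) (x : T.generator.domain) :
    T.HasGenValue (x : H) (T.generator x) :=
  Classical.choose_spec x.2

end C0Semigroup

/-- The resolvent set of a partially defined operator `A`: all `c : ℂ` for which
`A - c I : D(A) → H` is a bijection whose inverse `R` is a bounded operator on `H`. -/
def LinearPMap.unboundedResolventSet {H : Type*} [NormedAddCommGroup H] [InnerProductSpace ℂ H]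
    (A : H →ₗ.[ℂ] H) : Set ℂ :=
  {c | ∃ R : H →L[ℂ] H,
    (∀ x : A.domain, R (A x - c • (x : H)) = x) ∧
    (∀ y : H, ∃ x : A.domain, R y = x ∧ A x - c • (x : H) = y)}

/-- `V` is the cogenerator of the semigroup `T` with generator `A`: `1` lies in the resolvent set
of `A`, and `V = (A + I)(A - I)⁻¹`, i.e. `V` maps `(A - I) x` to `(A + I) x` for every
`x` in `D(A)`. As `A - I` maps `D(A)` onto `H`, there is at most one such `V`. -/
def C0Semigroup.IsCogenerator {H : Type*} [NormedAddCommGroup H] [InnerProductSpace ℂ H]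
    (T : C0Semigroup H) (V : H →L[ℂ] H) : Prop :=
  (1 : ℂ) ∈ T.generator.unboundedResolventSet ∧
    ∀ x : T.generator.domain, V (T.generator x - (x : H)) = T.generator x + (x : H)

/-!
Write `β n S x = ∑ₖ (n choose k) (-1)^(n-k) ‖Sᵏx‖²`, so that `S` is an `n`-isometry exactly when
`β n S` vanishes, and let `R = (A - I)⁻¹`, so that the cogenerator is `V = I + 2R`.

The resolvent `R` exists as soon as `T(1)` is an `m`-isometry: by the Gregory–Newton formula
`‖T(1)ⁿx‖²` is a polynomial in `n`, so `‖T(n)‖ < eⁿ` for some `n`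
(`IsMIsometry.exists_norm_pow_lt`), and then `A - I` is inverted by the truncated Laplace transform
`∫₀ⁿ e⁻ᵘ T(u) du` composed with a Neumann series (`C0Semigroup.exists_isResolventAtOne`).

The link between the two sides is the identity `d/dt β n V (T(t)Rx) = ½ β (n+1) V (T(t)x)`
(`C0Semigroup.IsResolventAtOne.hasDerivWithinAt_isometricDefect`). Starting from
`‖T(t)Rⁿx‖²`, it says that the `n`-th derivative in `t` of this function is `2⁻ⁿ β n V (T(t)x)`,
while its `n`-th forward difference at `0` with step `h` is `β n (T(h)) (Rⁿx)`. A mean value theorem for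
forward differences then gives `β n (T(h)) (Rⁿx) = (h/2)ⁿ β n V (T(ξ)x)` for some `ξ ∈ [0, nh]`
(`C0Semigroup.IsResolventAtOne.exists_isometricDefect_op_eq`). Since `Rⁿ` has dense
range, `V` being an `n`-isometry makes every `T(h)` one; letting `h → 0` gives the converse.

For strictness, if `V` is an `(n+1)`-isometry then `t ↦ β n V (T(t)Rx)` is constant, so a single
`T(h)` with `h > 0` that is an `n`-isometry forces `V` to be one
(`C0Semigroup.IsResolventAtOne.isMIsometry_cogenerator_of_succ`).
-/

/-! ### Defects of `m`-isometries -/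

section Defect

variable {H : Type*} [NormedAddCommGroup H] [InnerProductSpace ℂ H]

/-- The `n`-th isometric defect `∑ₖ (n choose k) (-1)^(n-k) ‖Sᵏx‖²` of `S` at `x`, encoded as the
`n`-th forward difference at `0` of the sequence `k ↦ ‖Sᵏx‖²`. -/
noncomputable def isometricDefect (n : ℕ) (S : H →L[ℂ] H) (x : H) : ℝ :=
  (fwdDiff 1)^[n] (fun k : ℕ => ‖(S ^ k) x‖ ^ 2) 0

theorem isometricDefect_eq_sum (n : ℕ) (S : H →L[ℂ] H) (x : H) :
    isometricDefect n S x = ∑ k ∈ Finset.range (n + 1),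
      (n.choose k : ℝ) * (-1) ^ (n - k) * ‖(S ^ k) x‖ ^ 2 := by
  rw [isometricDefect, fwdDiff_iter_eq_sum_shift]
  refine Finset.sum_congr rfl fun k _ => ?_
  simp [mul_comm]

theorem isMIsometry_iff_isometricDefect (n : ℕ) (S : H →L[ℂ] H) :
    IsMIsometry n S ↔ ∀ x, isometricDefect n S x = 0 := by
  simp only [IsMIsometry, isometricDefect_eq_sum]

@[simp]
theorem isometricDefect_zero (S : H →L[ℂ] H) (x : H) : isometricDefect 0 S x = ‖x‖ ^ 2 := by
  simp [isometricDefect]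

theorem isometricDefect_succ (n : ℕ) (S : H →L[ℂ] H) (x : H) :
    isometricDefect (n + 1) S x = isometricDefect n S (S x) - isometricDefect n S x := by
  rw [isometricDefect, Function.iterate_succ_apply', fwdDiff, isometricDefect, isometricDefect,
    ← fwdDiff_iter_comp_add]
  simp [pow_succ]

theorem continuous_isometricDefect (n : ℕ) (S : H →L[ℂ] H) :
    Continuous (isometricDefect n S) := by
  simp only [funext (isometricDefect_eq_sum n S)]
  fun_prop

theorem IsMIsometry.of_denseRange {n : ℕ} {S R : H →L[ℂ] H} (hR : DenseRange R)
    (h : ∀ x, isometricDefect n S (R x) = 0) : IsMIsometry n S := by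
  rw [isMIsometry_iff_isometricDefect]
  exact congrFun (hR.equalizer (continuous_isometricDefect n S) continuous_const (funext h))

theorem IsMIsometry.isometricDefect_eq_zero {n k : ℕ} {S : H →L[ℂ] H} (h : IsMIsometry n S)
    (hk : n ≤ k) (x : H) : isometricDefect k S x = 0 := by
  induction k, hk using Nat.le_induction generalizing x with
  | base => exact (isMIsometry_iff_isometricDefect n S).1 h x
  | succ k _ ih => rw [isometricDefect_succ, ih, ih, sub_zero]

theorem abs_isometricDefect_le (n : ℕ) (S : H →L[ℂ] H) (x : H) :
    |isometricDefect n S x| ≤ (‖S‖ ^ 2 + 1) ^ n * ‖x‖ ^ 2 := by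
  induction n generalizing x with
  | zero => simp
  | succ n ih =>
    rw [isometricDefect_succ]
    calc |isometricDefect n S (S x) - isometricDefect n S x|
        ≤ |isometricDefect n S (S x)| + |isometricDefect n S x| := abs_sub _ _
      _ ≤ (‖S‖ ^ 2 + 1) ^ n * (‖S‖ * ‖x‖) ^ 2 + (‖S‖ ^ 2 + 1) ^ n * ‖x‖ ^ 2 := by
        gcongr
        · refine (ih _).trans ?_
          gcongr
          exact S.le_opNorm x
        · exact ih x
      _ = (‖S‖ ^ 2 + 1) ^ (n + 1) * ‖x‖ ^ 2 := by ring

/-- The Gregory–Newton formula for `n ↦ ‖Sⁿx‖²`, which breaks off at degree `m` when `S` is an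
`m`-isometry. -/
theorem IsMIsometry.norm_pow_apply_sq {m : ℕ} {S : H →L[ℂ] H} (h : IsMIsometry m S) (n : ℕ)
    (x : H) : ‖(S ^ n) x‖ ^ 2 = ∑ k ∈ Finset.range m, (n.choose k : ℝ) * isometricDefect k S x := by
  have hN := shift_eq_sum_fwdDiff_iter 1 (fun k : ℕ => ‖(S ^ k) x‖ ^ 2) n 0
  simp only [smul_eq_mul, mul_one, zero_add, nsmul_eq_mul] at hN
  rw [hN]
  change ∑ k ∈ Finset.range (n + 1), (n.choose k : ℝ) * isometricDefect k S x = _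
  rw [Finset.sum_subset (Finset.range_subset_range.2 (le_max_left (n + 1) m)),
    Finset.sum_subset (Finset.range_subset_range.2 (le_max_right (n + 1) m))]
  · intro k _ hk
    rw [h.isometricDefect_eq_zero (by simpa using hk), mul_zero]
  · intro k _ hk
    rw [Nat.choose_eq_zero_of_lt (by simpa using hk), Nat.cast_zero, zero_mul]

/-- The powers of an `m`-isometry grow polynomially, hence slower than any exponential. -/
theorem IsMIsometry.exists_norm_pow_lt {m : ℕ} {S : H →L[ℂ] H} (h : IsMIsometry m S) {r : ℝ}
    (hr : 1 < r) : ∃ n : ℕ, ‖S ^ n‖ < r ^ n := by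
  have hlim : Tendsto (fun n : ℕ => ∑ k ∈ Finset.range m,
      (‖S‖ ^ 2 + 1) ^ k * ((n : ℝ) ^ k / (r ^ 2) ^ n)) atTop (𝓝 0) := by
    rw [← Finset.sum_const_zero (s := Finset.range m)]
    refine tendsto_finsetSum _ fun k _ => ?_
    simpa using (tendsto_pow_const_div_const_pow_of_one_lt k
      (one_lt_pow₀ hr two_ne_zero)).const_mul ((‖S‖ ^ 2 + 1) ^ k)
  obtain ⟨n, hn⟩ := (hlim.eventually_lt_const one_pos).exists
  refine ⟨n, ?_⟩
  have hr0 : 0 < r := one_pos.trans hr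
  set a : ℝ := ∑ k ∈ Finset.range m, (‖S‖ ^ 2 + 1) ^ k * ((n : ℝ) ^ k / (r ^ 2) ^ n)
  have ha : 0 ≤ a := Finset.sum_nonneg fun k _ => by positivity
  have hb : ‖S ^ n‖ ≤ √a * r ^ n := by
    refine ContinuousLinearMap.opNorm_le_bound _ (by positivity) fun x => ?_
    refine le_of_sq_le_sq ?_ (by positivity)
    calc ‖(S ^ n) x‖ ^ 2 = ∑ k ∈ Finset.range m, (n.choose k : ℝ) * isometricDefect k S x :=
          h.norm_pow_apply_sq n x
      _ ≤ ∑ k ∈ Finset.range m, (n : ℝ) ^ k * ((‖S‖ ^ 2 + 1) ^ k * ‖x‖ ^ 2) := by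
        refine Finset.sum_le_sum fun k _ => ?_
        refine mul_le_mul_of_nonneg_left ((le_abs_self _).trans (abs_isometricDefect_le k S x))
          (by positivity) |>.trans ?_
        gcongr
        exact_mod_cast Nat.choose_le_pow n k
      _ = a * (r ^ 2) ^ n * ‖x‖ ^ 2 := by
        rw [Finset.sum_mul, Finset.sum_mul]
        refine Finset.sum_congr rfl fun k _ => ?_
        field_simp
      _ = (√a * r ^ n * ‖x‖) ^ 2 := by
        rw [mul_pow, mul_pow, Real.sq_sqrt ha]; ring
  have hs : √a < 1 := by rwa [Real.sqrt_lt' one_pos, one_pow]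
  exact hb.trans_lt (by simpa using mul_lt_mul_of_pos_right hs (pow_pos hr0 n))

end Defect

/-! ### A mean value theorem for iterated forward differences -/

section MeanValue

/-- A continuous function with a continuous right derivative on `[0, ∞)` is differentiable in the
interior. -/
theorem hasDerivAt_of_continuous_right_deriv {g g' : ℝ → ℝ} (hg : Continuous g)
    (hg' : Continuous g') (h : ∀ t, 0 ≤ t → HasDerivWithinAt g (g' t) (Set.Ici t) t)
    {t : ℝ} (ht : 0 < t) : HasDerivAt g (g' t) t := by
  have hI : ∀ s, HasDerivAt (fun s => g 0 + ∫ u in (0 : ℝ)..s, g' u) (g' s) s := fun s =>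
    (intervalIntegral.integral_hasDerivAt_right (hg'.intervalIntegrable _ _)
      hg'.stronglyMeasurable.stronglyMeasurableAtFilter hg'.continuousAt).const_add _
  refine (hI t).congr_of_eventuallyEq ?_
  filter_upwards [lt_mem_nhds ht] with s hs
  rw [intervalIntegral.integral_eq_sub_of_hasDeriv_right_of_le hs.le hg.continuousOn
    (fun u hu => (h u hu.1.le).mono Set.Ioi_subset_Ici_self) (hg'.intervalIntegrable _ _)]
  ring

/-- The mean value theorem for higher differences: if `f (j + 1)` is the derivative of `f j` on
`[0, ∞)` then `Δₕⁿ (f 0) t = hⁿ f n ξ` for some `ξ ∈ [t, t + nh]`. -/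
theorem exists_fwdDiff_iter_eq_pow_mul {f : ℕ → ℝ → ℝ} {n : ℕ}
    (hc : ∀ j ≤ n, Continuous (f j))
    (hd : ∀ j < n, ∀ t, 0 ≤ t → HasDerivWithinAt (f j) (f (j + 1) t) (Set.Ici t) t)
    {h t : ℝ} (hh : 0 < h) (ht : 0 ≤ t) :
    ∃ ξ ∈ Set.Icc t (t + n * h), (fwdDiff h)^[n] (f 0) t = h ^ n * f n ξ := by
  induction n generalizing f with
  | zero => exact ⟨t, by simp, by simp⟩
  | succ n ih =>
    obtain ⟨ξ, hξ, e⟩ := ih (f := fun j => fwdDiff h (f j))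
      (fun j hj => by
        have := hc j (by omega)
        unfold fwdDiff
        fun_prop)
      (fun j hj s hs => by
        refine HasDerivWithinAt.sub ?_ (hd j (by omega) s hs)
        have := (hd j (by omega) (s + h) (by positivity)).scomp s
          (((hasDerivAt_id s).add_const h).hasDerivWithinAt (s := Set.Ici s))
          (fun u hu => by simpa using hu)
        simpa [Function.comp_def] using this)
    have hξ0 : 0 ≤ ξ := ht.trans hξ.1
    obtain ⟨η, hη, e'⟩ := exists_hasDerivAt_eq_slope (f n) (f (n + 1)) (lt_add_of_pos_right ξ hh)
      (hc n (by omega)).continuousOn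
      (fun u hu => hasDerivAt_of_continuous_right_deriv (hc n (by omega)) (hc _ le_rfl)
        (hd n (by omega)) (hξ0.trans_lt hu.1))
    refine ⟨η, ⟨hξ.1.trans hη.1.le, hη.2.le.trans ?_⟩, ?_⟩
    · push_cast
      linarith [hξ.2]
    · rw [Function.iterate_succ_apply, e, e', fwdDiff, add_sub_cancel_left]
      field_simp
      ring

end MeanValue

/-! ### Orbits of a `C₀`-semigroup -/

namespace C0Semigroup

section Orbit

variable {H : Type*} [NormedAddCommGroup H] [InnerProductSpace ℂ H] (T : C0Semigroup H)

theorem op_add_apply (s t : ℝ≥0) (x : H) : T.op (s + t) x = T.op s (T.op t x) := by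
  rw [add_comm, T.op_add]; rfl

theorem op_comm_apply (s t : ℝ≥0) (x : H) : T.op s (T.op t x) = T.op t (T.op s x) := by
  rw [← op_add_apply, add_comm, op_add_apply]

theorem op_nsmul (n : ℕ) (t : ℝ≥0) : T.op (n • t) = T.op t ^ n := by
  induction n with
  | zero => simp [T.op_zero]
  | succ n ih => rw [succ_nsmul, T.op_add, ih, pow_succ']

theorem tendsto_op_nhds_zero (x : H) : Tendsto (fun t => T.op t x) (𝓝 0) (𝓝 x) := by
  have h : ContinuousWithinAt (fun t => T.op t x) (Set.Ioi 0) 0 := by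
    simpa [ContinuousWithinAt, T.op_zero] using T.tendsto_op x
  have h' : ContinuousWithinAt (fun t => T.op t x) (Set.Ici 0) 0 :=
    continuousWithinAt_Ioi_iff_Ici.1 h
  have hu : Set.Ici (0 : ℝ≥0) = Set.univ := Set.Ici_bot
  rw [hu, continuousWithinAt_univ] at h'
  simpa [ContinuousAt, T.op_zero] using h'

/-- Boundedness near `0`: otherwise some sequence `T(sₙ)` with `sₙ → 0` would be unbounded in norm
although it converges pointwise, against the uniform boundedness principle. -/
theorem exists_norm_op_le_near_zero [CompleteSpace H] :
    ∃ δ > 0, ∃ M : ℝ, ∀ t ≤ δ, ‖T.op t‖ ≤ M := by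
  by_contra! hcon
  have hpos : ∀ n : ℕ, (0 : ℝ≥0) < 1 / (n + 1) := fun n => by positivity
  choose s hs hsn using fun n : ℕ => hcon _ (hpos n) n
  have hs0 : Tendsto s atTop (𝓝 0) :=
    tendsto_of_tendsto_of_tendsto_of_le_of_le tendsto_const_nhds
      tendsto_one_div_add_atTop_nhds_zero_nat (fun _ => zero_le) hs
  obtain ⟨C, hC⟩ := banach_steinhaus (g := fun n => T.op (s n)) fun x => by
    obtain ⟨C, hC⟩ := ((T.tendsto_op_nhds_zero x).comp hs0).norm.bddAbove_range
    exact ⟨C, fun n => hC ⟨n, rfl⟩⟩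
  obtain ⟨n, hn⟩ := exists_nat_gt C
  exact absurd (hsn n) (not_lt.2 ((hC n).trans hn.le))

theorem exists_norm_op_le [CompleteSpace H] (a : ℝ≥0) : ∃ M : ℝ, ∀ t ≤ a, ‖T.op t‖ ≤ M := by
  obtain ⟨δ, hδ, M, hM⟩ := T.exists_norm_op_le_near_zero
  obtain ⟨n, hn⟩ := Archimedean.arch a hδ
  refine ⟨M ^ n * M, fun t ht => ?_⟩
  have hM0 : 0 ≤ M := (norm_nonneg _).trans (hM 0 zero_le)
  -- `t = n • (t / (n + 1)) + t / (n + 1)` with `t / (n + 1) ≤ δ`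
  have hle : t / (n + 1) ≤ δ := by
    refine div_le_of_le_mul₀ zero_le zero_le (ht.trans (hn.trans ?_))
    rw [nsmul_eq_mul, mul_comm]
    gcongr
    simp
  have ht' : t = n • (t / (n + 1)) + t / (n + 1) := by
    rw [← succ_nsmul, nsmul_eq_mul]
    push_cast
    field_simp
  rw [ht', add_comm, T.op_add, op_nsmul]
  refine (norm_mul_le _ _).trans (mul_le_mul ?_ (hM _ hle) (norm_nonneg _) (by positivity))
  rcases n.eq_zero_or_pos with rfl | h0
  · exact ContinuousLinearMap.norm_id_le
  · exact (norm_pow_le' _ h0).trans (by gcongr; exact hM _ hle)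

theorem continuous_op_apply [CompleteSpace H] (x : H) : Continuous fun t => T.op t x := by
  rw [continuous_iff_continuousAt]
  intro t
  obtain ⟨M, hM⟩ := T.exists_norm_op_le (t + 1)
  have hM0 : 0 ≤ M := (norm_nonneg _).trans (hM 0 zero_le)
  -- for `u ≤ v`, `T(v)x - T(u)x = T(u)(T(v - u)x - x)`
  have key : ∀ u v, u ≤ v → v ≤ t + 1 → ‖T.op v x - T.op u x‖ ≤ M * ‖T.op (v - u) x - x‖ := by
    intro u v huv hv
    have e : T.op v x - T.op u x = T.op u (T.op (v - u) x - x) := by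
      rw [map_sub, ← op_add_apply, add_tsub_cancel_of_le huv]
    rw [e]
    exact (T.op u).le_of_opNorm_le (hM u (huv.trans hv)) _
  have hlim : Tendsto (fun s => M * ‖T.op (s - t + (t - s)) x - x‖) (𝓝 t) (𝓝 0) := by
    have h1 : Tendsto (fun s : ℝ≥0 => s - t + (t - s)) (𝓝 t) (𝓝 0) := by
      have : Continuous fun s : ℝ≥0 => s - t + (t - s) := by fun_prop
      simpa using this.tendsto t
    simpa using ((((T.tendsto_op_nhds_zero x).comp h1).sub_const x).norm).const_mul M
  rw [ContinuousAt, tendsto_iff_norm_sub_tendsto_zero]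
  refine squeeze_zero' (.of_forall fun _ => norm_nonneg _) ?_ hlim
  filter_upwards [gt_mem_nhds (lt_add_of_pos_right t one_pos)] with s hs
  rcases le_total s t with h | h
  · rw [norm_sub_rev, tsub_eq_zero_of_le h, zero_add]
    exact key s t h (by simp)
  · rw [tsub_eq_zero_of_le h, add_zero]
    exact key t s h hs.le

/-- The orbit of `x`, extended to the negative axis by its value at `0` so that calculus on `ℝ`
applies. -/
noncomputable def orbit (x : H) (t : ℝ) : H := T.op t.toNNReal x

@[simp]
theorem orbit_zero (x : H) : T.orbit x 0 = x := by simp [orbit, T.op_zero]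

theorem continuous_orbit [CompleteSpace H] (x : H) : Continuous (T.orbit x) :=
  (T.continuous_op_apply x).comp continuous_real_toNNReal

theorem orbit_add {s t : ℝ} (hs : 0 ≤ s) (ht : 0 ≤ t) (x : H) :
    T.orbit x (s + t) = T.op s.toNNReal (T.orbit x t) := by
  rw [orbit, Real.toNNReal_add hs ht, op_add_apply]; rfl

theorem hasGenValue_iff_hasDerivWithinAt {x y : H} :
    T.HasGenValue x y ↔ HasDerivWithinAt (T.orbit x) y (Set.Ici 0) 0 := by
  rw [← hasDerivWithinAt_Ioi_iff_Ici, hasDerivWithinAt_iff_tendsto_slope'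
    Set.self_notMem_Ioi, HasGenValue]
  have e : ∀ t : ℝ, 0 ≤ t → slope (T.orbit x) 0 t =
      (((t.toNNReal : ℝ) : ℂ))⁻¹ • (T.op t.toNNReal x - x) := fun t ht => by
    rw [slope_def_module, orbit_zero, sub_zero, Real.coe_toNNReal t ht, ← Complex.ofReal_inv,
      Complex.coe_smul, orbit]
  constructor <;> intro h
  · have hl : Tendsto Real.toNNReal (𝓝[>] 0) (𝓝[>] 0) := by
      refine tendsto_nhdsWithin_iff.2 ⟨?_, ?_⟩
      · simpa using (continuous_real_toNNReal.tendsto 0).mono_left nhdsWithin_le_nhds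
      · filter_upwards [self_mem_nhdsWithin] with t ht
        simpa using ht
    refine (h.comp hl).congr' ?_
    filter_upwards [self_mem_nhdsWithin] with t ht
    exact (e t (le_of_lt ht)).symm
  · have hl : Tendsto ((↑) : ℝ≥0 → ℝ) (𝓝[>] 0) (𝓝[>] 0) := by
      refine tendsto_nhdsWithin_iff.2 ⟨?_, ?_⟩
      · simpa using (NNReal.continuous_coe.tendsto 0).mono_left nhdsWithin_le_nhds
      · filter_upwards [self_mem_nhdsWithin] with t ht
        simpa using ht
    refine (h.comp hl).congr fun t => ?_
    rw [Function.comp_apply, e t t.2, Real.toNNReal_coe]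

variable {T}

theorem HasGenValue.op_apply {x y : H} (h : T.HasGenValue x y) (t : ℝ≥0) :
    T.HasGenValue (T.op t x) (T.op t y) := by
  refine (((T.op t).continuous.tendsto y).comp h).congr fun s => ?_
  rw [Function.comp_apply, map_smul, map_sub, T.op_comm_apply]

theorem HasGenValue.hasDerivWithinAt_orbit {x y : H} (h : T.HasGenValue x y) {t : ℝ}
    (ht : 0 ≤ t) : HasDerivWithinAt (T.orbit x) (T.orbit y t) (Set.Ici t) t := by
  have h0 : HasDerivWithinAt (T.orbit (T.orbit x t)) (T.orbit y t) (Set.Ici 0) (t - t) := by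
    rw [sub_self]
    exact T.hasGenValue_iff_hasDerivWithinAt.1 (h.op_apply _)
  have hs : HasDerivWithinAt (fun u => u - t) 1 (Set.Ici t) t :=
    (hasDerivWithinAt_id t _).sub_const t
  have h1 := HasDerivWithinAt.scomp (h := fun u => u - t) t h0 hs
    (fun u hu => Set.mem_Ici.2 (sub_nonneg.2 (Set.mem_Ici.1 hu)))
  rw [one_smul] at h1
  refine h1.congr (fun u hu => ?_) ?_
  · have hu' : 0 ≤ u - t := sub_nonneg.2 hu
    simpa [orbit] using T.orbit_add hu' ht x
  · simp [orbit, T.op_zero]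

end Orbit

end C0Semigroup

/-! ### The resolvent at `1` -/

namespace C0Semigroup

section Resolvent

variable {H : Type*} [NormedAddCommGroup H] [InnerProductSpace ℂ H]

/-- `R = (A - I)⁻¹` for the generator `A` of `T`, phrased through `HasGenValue`: `R y` lies in
`D(A)` with `A (R y) = y + R y`, and `R (A x - x) = x` for `x ∈ D(A)`. -/
structure IsResolventAtOne (T : C0Semigroup H) (R : H →L[ℂ] H) : Prop where
  hasGenValue : ∀ y, T.HasGenValue (R y) (y + R y)
  apply_sub : ∀ {x y}, T.HasGenValue x y → R (y - x) = x

variable {T : C0Semigroup H} {R : H →L[ℂ] H}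

theorem one_mem_unboundedResolventSet_iff :
    (1 : ℂ) ∈ T.generator.unboundedResolventSet ↔ ∃ R, T.IsResolventAtOne R := by
  refine exists_congr fun R => ⟨fun ⟨h1, h2⟩ => ⟨fun y => ?_, fun {x y} h => ?_⟩,
    fun h => ⟨fun x => ?_, fun y => ⟨⟨R y, _, h.hasGenValue y⟩, rfl, ?_⟩⟩⟩
  · obtain ⟨x, hx, e⟩ := h2 y
    rw [one_smul] at e
    rw [hx, ← e, sub_add_cancel]
    exact T.generator_spec x
  · have := h1 ⟨x, y, h⟩
    rwa [one_smul, (T.generator_spec ⟨x, y, h⟩).unique h] at this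
  · rw [one_smul]
    exact h.apply_sub (T.generator_spec x)
  · rw [one_smul, (T.generator_spec ⟨R y, _, h.hasGenValue y⟩).unique (h.hasGenValue y),
      add_sub_cancel_right]

/-- In terms of the resolvent `R = (A - I)⁻¹`, the cogenerator is `I + 2R`. -/
theorem IsResolventAtOne.isCogenerator_iff (h : T.IsResolventAtOne R) {V : H →L[ℂ] H} :
    T.IsCogenerator V ↔ V = 1 + (2 : ℂ) • R := by
  constructor
  · rintro ⟨-, hV⟩
    ext y
    have := hV ⟨R y, _, h.hasGenValue y⟩
    rw [(T.generator_spec ⟨R y, _, h.hasGenValue y⟩).unique (h.hasGenValue y),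
      add_sub_cancel_right] at this
    rw [this]
    simp [two_smul, add_assoc]
  · rintro rfl
    refine ⟨one_mem_unboundedResolventSet_iff.2 ⟨R, h⟩, fun x => ?_⟩
    simp only [add_apply, one_apply_eq_self, h.apply_sub (T.generator_spec x), two_smul]
    abel

theorem IsResolventAtOne.op_apply (h : T.IsResolventAtOne R) (t : ℝ≥0) (x : H) :
    T.op t (R x) = R (T.op t x) := by
  have := h.apply_sub ((h.hasGenValue x).op_apply t)
  rw [← this, map_add, add_sub_cancel_right]

variable [CompleteSpace H]

theorem continuous_exp_smul_orbit (T : C0Semigroup H) (x : H) :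
    Continuous fun u : ℝ => Real.exp (-u) • T.orbit x u := by
  have := T.continuous_orbit x
  fun_prop

variable (T) in
/-- The truncated Laplace transform `x ↦ ∫₀^τ e⁻ᵘ T(u)x du` at `1`. -/
noncomputable def truncatedLaplace (τ : ℝ≥0) : H →L[ℂ] H :=
  LinearMap.mkContinuousOfExistsBound
    { toFun := fun x => ∫ u in (0 : ℝ)..τ, Real.exp (-u) • T.orbit x u
      map_add' := fun x y => by
        rw [← intervalIntegral.integral_add
          ((T.continuous_exp_smul_orbit x).intervalIntegrable _ _)
          ((T.continuous_exp_smul_orbit y).intervalIntegrable _ _)]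
        simp [orbit]
      map_smul' := fun c x => by
        rw [RingHom.id_apply, ← intervalIntegral.integral_smul]
        simp only [orbit, map_smul, smul_comm c] }
    (by
      obtain ⟨M, hM⟩ := T.exists_norm_op_le τ
      refine ⟨M * τ, fun x => ?_⟩
      have hb : ∀ u ∈ Set.uIoc (0 : ℝ) τ, ‖Real.exp (-u) • T.orbit x u‖ ≤ M * ‖x‖ := by
        intro u hu
        rw [Set.uIoc_of_le τ.coe_nonneg] at hu
        rw [norm_smul, Real.norm_of_nonneg (Real.exp_pos _).le, ← one_mul (M * ‖x‖)]
        refine mul_le_mul (Real.exp_le_one_iff.2 (by linarith [hu.1]))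
          ((T.op _).le_of_opNorm_le (hM _ (Real.toNNReal_le_iff_le_coe.2 hu.2)) x)
          (norm_nonneg _) zero_le_one
      have := intervalIntegral.norm_integral_le_of_norm_le_const hb
      rw [sub_zero, abs_of_nonneg τ.coe_nonneg] at this
      simpa [mul_right_comm] using this)

theorem truncatedLaplace_apply (τ : ℝ≥0) (x : H) :
    T.truncatedLaplace τ x = ∫ u in (0 : ℝ)..τ, Real.exp (-u) • T.orbit x u := rfl

theorem orbit_truncatedLaplace {h : ℝ} (hh : 0 ≤ h) (τ : ℝ≥0) (x : H) :
    T.orbit (T.truncatedLaplace τ x) h =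
      Real.exp h • ∫ u in h..τ + h, Real.exp (-u) • T.orbit x u := by
  have e : ∫ u in h..τ + h, Real.exp (-u) • T.orbit x u =
      ∫ u in (0 : ℝ)..τ, Real.exp (-(u + h)) • T.orbit x (u + h) := by
    rw [intervalIntegral.integral_comp_add_right (fun u => Real.exp (-u) • T.orbit x u), zero_add]
  rw [e, ← intervalIntegral.integral_smul, orbit, truncatedLaplace_apply,
    ← ContinuousLinearMap.intervalIntegral_comp_comm _
      ((T.continuous_exp_smul_orbit x).intervalIntegrable _ _)]
  refine intervalIntegral.integral_congr fun u hu => ?_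
  rw [Set.uIcc_of_le τ.coe_nonneg] at hu
  rw [smul_smul, ← Real.exp_add, add_comm u h, T.orbit_add hh hu.1]
  rw [show h + -(h + u) = -u by ring]
  exact ContinuousLinearMap.map_smul_of_tower _ _ _

/-- `(A - I) ∫₀^τ e⁻ᵘ T(u)x du = e^(-τ) T(τ)x - x`. -/
theorem hasGenValue_truncatedLaplace (τ : ℝ≥0) (x : H) :
    T.HasGenValue (T.truncatedLaplace τ x)
      ((Real.exp (-τ) • T.op τ x - x) + T.truncatedLaplace τ x) := by
  have hg := T.continuous_exp_smul_orbit x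
  set g : ℝ → H := fun u => Real.exp (-u) • T.orbit x u with hgdef
  rw [hasGenValue_iff_hasDerivWithinAt]
  have hG : ∀ s, HasDerivAt (fun s => ∫ u in (0 : ℝ)..s, g u) (g s) s := fun s =>
    intervalIntegral.integral_hasDerivAt_right (hg.intervalIntegrable _ _)
      hg.stronglyMeasurable.stronglyMeasurableAtFilter hg.continuousAt
  have hG' : HasDerivAt (fun s : ℝ => ∫ u in (0 : ℝ)..τ + s, g u) (g τ) 0 := by
    have h1 : HasDerivAt (fun s => ∫ u in (0 : ℝ)..s, g u) (g τ) (τ + 0 : ℝ) := by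
      simpa using hG τ
    simpa [Function.comp_def] using h1.scomp (0 : ℝ) ((hasDerivAt_id (0 : ℝ)).const_add (τ : ℝ))
  have hD := (Real.hasDerivAt_exp 0).smul (hG'.sub (hG 0))
  have hev : ∀ h : ℝ, 0 ≤ h → T.orbit (T.truncatedLaplace τ x) h =
      Real.exp h • ((∫ u in (0 : ℝ)..τ + h, g u) - ∫ u in (0 : ℝ)..h, g u) := fun h hh => by
    rw [orbit_truncatedLaplace hh, intervalIntegral.integral_interval_sub_left
      (hg.intervalIntegrable _ _) (hg.intervalIntegrable _ _)]
  refine (hD.hasDerivWithinAt.congr (fun h hh => hev h hh) (hev 0 le_rfl)).congr_deriv ?_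
  simp [hgdef, truncatedLaplace_apply, orbit, T.op_zero]

/-- `∫₀^τ e⁻ᵘ T(u)(A - I)x du = e^(-τ) T(τ)x - x` for `x ∈ D(A)`. -/
theorem HasGenValue.truncatedLaplace_apply_sub {x y : H} (h : T.HasGenValue x y) (τ : ℝ≥0) :
    T.truncatedLaplace τ (y - x) = Real.exp (-τ) • T.op τ x - x := by
  have hd : ∀ u ∈ Set.Ioo (0 : ℝ) τ, HasDerivWithinAt (fun u => Real.exp (-u) • T.orbit x u)
      (Real.exp (-u) • T.orbit (y - x) u) (Set.Ioi u) u := fun u hu => by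
    have h1 := ((hasDerivAt_id u).neg.exp.hasDerivWithinAt (s := Set.Ici u)).smul
      (h.hasDerivWithinAt_orbit hu.1.le)
    refine (h1.mono Set.Ioi_subset_Ici_self).congr_deriv ?_
    simp [orbit, sub_eq_add_neg]
  rw [truncatedLaplace_apply, intervalIntegral.integral_eq_sub_of_hasDeriv_right_of_le τ.coe_nonneg
    (T.continuous_exp_smul_orbit x).continuousOn hd
    ((T.continuous_exp_smul_orbit _).intervalIntegrable _ _)]
  simp [orbit, T.op_zero]

/-- If `‖T(τ)‖ < e^τ` then `e^(-τ) T(τ) - I` is invertible by the Neumann series, and composing its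
inverse with the truncated Laplace transform inverts `A - I`. -/
theorem exists_isResolventAtOne {τ : ℝ≥0} (hτ : ‖T.op τ‖ < Real.exp τ) :
    ∃ R, T.IsResolventAtOne R := by
  set S : H →L[ℂ] H := ((Real.exp (-τ) : ℝ) : ℂ) • T.op τ with hS
  have hSn : ‖S‖ < 1 := by
    rw [hS, norm_smul, Complex.norm_real, Real.norm_of_nonneg (Real.exp_pos _).le, Real.exp_neg,
      inv_mul_lt_iff₀ (Real.exp_pos _), mul_one]
    exact hτ
  have hSx : ∀ x, (1 - S) x = x - Real.exp (-τ) • T.op τ x := fun x => by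
    rw [sub_apply, one_apply_eq_self, hS, smul_apply, Complex.coe_smul]
  obtain ⟨W, hW, hinj⟩ : ∃ W : H →L[ℂ] H, (∀ x, Real.exp (-τ) • T.op τ (W x) - W x = -x) ∧
      ∀ x, Real.exp (-τ) • T.op τ x - x = 0 → x = 0 := by
    obtain ⟨u, hu⟩ := isUnit_one_sub_of_norm_lt_one hSn
    refine ⟨(↑u⁻¹ : H →L[ℂ] H), fun x => ?_, fun x hx => ?_⟩
    · have h1 := DFunLike.congr_fun u.mul_inv x
      rw [mul_apply_eq_comp, hu, hSx, one_apply_eq_self] at h1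
      rw [← neg_sub, h1]
    · have h1 := DFunLike.congr_fun u.inv_mul x
      rw [mul_apply_eq_comp, hu, hSx, one_apply_eq_self, ← neg_sub, hx, neg_zero, map_zero] at h1
      exact h1.symm
  have hRW : ∀ y, (-(T.truncatedLaplace τ ∘L W)) y = -T.truncatedLaplace τ (W y) := fun y => rfl
  have hR : ∀ y, T.HasGenValue (-T.truncatedLaplace τ (W y))
      (y + -T.truncatedLaplace τ (W y)) := fun y => by
    have h1 := (T.hasGenValue_truncatedLaplace τ (W y)).smul (-1)
    rw [hW] at h1
    simpa [add_comm] using h1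
  refine ⟨-(T.truncatedLaplace τ ∘L W), fun y => by simpa only [hRW] using hR y,
    fun {x y} hxy => ?_⟩
  -- `z = R (A - I)x - x` is annihilated by `A - I`, hence by `e^(-τ) T(τ) - I`
  rw [hRW]
  have hz := (hR (y - x)).add (hxy.smul (-1))
  have hz' := hz.truncatedLaplace_apply_sub τ
  rw [show y - x + -T.truncatedLaplace τ (W (y - x)) + (-1 : ℂ) • y -
    (-T.truncatedLaplace τ (W (y - x)) + (-1 : ℂ) • x) = 0 by module, map_zero] at hz'
  have h1 := hinj _ hz'.symm
  rwa [neg_smul, one_smul, ← sub_eq_add_neg, sub_eq_zero] at h1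

/-- The range of the resolvent is `D(A)`, which contains the averages
`τ⁻¹ ∫₀^τ e⁻ᵘ T(u)x du → x`. -/
theorem IsResolventAtOne.denseRange (h : T.IsResolventAtOne R) : DenseRange R := by
  intro x
  have hg := T.continuous_exp_smul_orbit x
  have hG : HasDerivAt (fun s : ℝ => ∫ u in (0 : ℝ)..s, Real.exp (-u) • T.orbit x u) x 0 := by
    simpa using intervalIntegral.integral_hasDerivAt_right (hg.intervalIntegrable 0 0)
      hg.stronglyMeasurable.stronglyMeasurableAtFilter hg.continuousAt
  have hl := (hasDerivWithinAt_iff_tendsto_slope' (Set.self_notMem_Ioi (a := (0 : ℝ)))).1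
    hG.hasDerivWithinAt
  refine mem_closure_of_tendsto hl ?_
  filter_upwards [self_mem_nhdsWithin] with s hs
  have hs' : 0 ≤ s := le_of_lt hs
  refine ⟨((s⁻¹ : ℝ) : ℂ) • ((Real.exp (-s) • T.op s.toNNReal x - x)), ?_⟩
  have := h.apply_sub (T.hasGenValue_truncatedLaplace s.toNNReal x)
  rw [add_sub_cancel_right, Real.coe_toNNReal s hs'] at this
  rw [map_smul, this, slope_def_module, truncatedLaplace_apply, Real.coe_toNNReal s hs']
  rw [Complex.coe_smul, intervalIntegral.integral_same, sub_zero, sub_zero]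

end Resolvent

end C0Semigroup

/-! ### Comparing the semigroup with its cogenerator -/

namespace C0Semigroup

section Cogenerator

variable {H : Type*} [NormedAddCommGroup H] [InnerProductSpace ℂ H] {T : C0Semigroup H}
  {R : H →L[ℂ] H}

/-- With `V = I + 2R`, differentiating the `n`-th defect of `V` along the orbit of `R x` gives half
the `(n + 1)`-st defect of `V` along the orbit of `x`. For `n = 0` this is the identity
`2 Re ⟪R y, y + R y⟫ = (‖V y‖² - ‖y‖²) / 2`. -/
theorem IsResolventAtOne.hasDerivWithinAt_isometricDefect (h : T.IsResolventAtOne R) (n : ℕ) (x : H)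
    {t : ℝ} (ht : 0 ≤ t) :
    HasDerivWithinAt (fun s => isometricDefect n (1 + (2 : ℂ) • R) (T.orbit (R x) s))
      (1 / 2 * isometricDefect (n + 1) (1 + (2 : ℂ) • R) (T.orbit x t)) (Set.Ici t) t := by
  have hV : ∀ y, (1 + (2 : ℂ) • R) y = y + (R y + R y) := fun y => by simp [two_smul]
  have hTV : ∀ y s, (1 + (2 : ℂ) • R) (T.orbit y s) = T.orbit ((1 + (2 : ℂ) • R) y) s :=
    fun y s => by simp only [hV, orbit, map_add, h.op_apply]
  induction n generalizing x with
  | zero =>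
    let _ := InnerProductSpace.complexToReal (G := H)
    have hd := ((h.hasGenValue x).hasDerivWithinAt_orbit ht).norm_sq
    simp only [isometricDefect_succ, isometricDefect_zero, hV]
    refine hd.congr_deriv ?_
    have e : R (T.orbit x t) = T.orbit (R x) t := (h.op_apply _ _).symm
    have e' : T.orbit (x + R x) t = T.orbit x t + T.orbit (R x) t := map_add _ _ _
    rw [e, e', norm_add_sq_real, norm_add_sq_real (T.orbit (R x) t), inner_add_right,
      inner_add_right, real_inner_self_eq_norm_sq, real_inner_comm]
    ring
  | succ n ih =>
    have hRV : (1 + (2 : ℂ) • R) (R x) = R ((1 + (2 : ℂ) • R) x) := by simp only [hV, map_add]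
    have hd := (ih ((1 + (2 : ℂ) • R) x)).sub (ih x)
    rw [← mul_sub, ← hTV, ← isometricDefect_succ, ← hRV] at hd
    refine hd.congr (fun s _ => ?_) ?_ <;> rw [isometricDefect_succ, hTV] <;> rfl

variable [CompleteSpace H]

/-- The bridge between the semigroup and its cogenerator `V = I + 2R`: the defect of `T(h)` on the
range of `Rⁿ` is a multiple of the defect of `V` at an intermediate point of the orbit. -/
theorem IsResolventAtOne.exists_isometricDefect_op_eq (h : T.IsResolventAtOne R) (n : ℕ) (x : H)
    {δ : ℝ≥0} (hδ : 0 < δ) :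
    ∃ ξ ∈ Set.Icc (0 : ℝ) (n * δ), isometricDefect n (T.op δ) ((R ^ n) x) =
      (δ / 2) ^ n * isometricDefect n (1 + (2 : ℂ) • R) (T.orbit x ξ) := by
  obtain ⟨ξ, hξ, e⟩ := exists_fwdDiff_iter_eq_pow_mul (n := n) (t := 0)
    (hh := NNReal.coe_pos.2 hδ) (ht := le_rfl)
    (f := fun j t => (1 / 2) ^ j *
      isometricDefect j (1 + (2 : ℂ) • R) (T.orbit ((R ^ (n - j)) x) t))
    (fun j _ => continuous_const.mul
      ((continuous_isometricDefect j _).comp (T.continuous_orbit _)))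
    (fun j hj t ht => by
      have hs : n - j = n - (j + 1) + 1 := by omega
      have hd := (h.hasDerivWithinAt_isometricDefect j ((R ^ (n - (j + 1))) x) ht).const_mul
        ((1 / 2 : ℝ) ^ j)
      rw [← mul_assoc, ← pow_succ] at hd
      rw [hs, pow_succ']
      exact hd)
  rw [zero_add] at hξ
  refine ⟨ξ, hξ, ?_⟩
  have hL : isometricDefect n (T.op δ) ((R ^ n) x) = (fwdDiff (δ : ℝ))^[n]
      (fun t => ‖T.orbit ((R ^ n) x) t‖ ^ 2) 0 := by
    rw [isometricDefect, fwdDiff_iter_eq_sum_shift, fwdDiff_iter_eq_sum_shift]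
    refine Finset.sum_congr rfl fun k _ => ?_
    congr 2
    rw [zero_add, zero_add, ← NNReal.coe_nsmul, orbit, Real.toNNReal_coe, op_nsmul, smul_eq_mul,
      mul_one]
  rw [hL, div_pow, ← mul_one_div, ← one_div_pow, mul_assoc]
  simpa using e

theorem IsResolventAtOne.denseRange_pow (h : T.IsResolventAtOne R) (n : ℕ) :
    DenseRange (R ^ n : H →L[ℂ] H) := by
  induction n with
  | zero => exact denseRange_id
  | succ n ih =>
    rw [pow_succ]
    exact ih.comp h.denseRange (R ^ n).continuous

theorem IsResolventAtOne.isMIsometry_op (h : T.IsResolventAtOne R) {n : ℕ}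
    (hV : IsMIsometry n (1 + (2 : ℂ) • R)) {t : ℝ≥0} (ht : 0 < t) : IsMIsometry n (T.op t) := by
  refine .of_denseRange (h.denseRange_pow n) fun x => ?_
  obtain ⟨ξ, -, e⟩ := h.exists_isometricDefect_op_eq n x ht
  rw [e, (isMIsometry_iff_isometricDefect _ _).1 hV, mul_zero]

/-- The intermediate points `ξ` tend to `0` with the step, so the defect of the cogenerator vanishes
by continuity of the orbits. -/
theorem IsResolventAtOne.isMIsometry_cogenerator (h : T.IsResolventAtOne R) {n : ℕ}
    (hT : ∀ t, 0 < t → IsMIsometry n (T.op t)) : IsMIsometry n (1 + (2 : ℂ) • R) := by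
  rw [isMIsometry_iff_isometricDefect]
  intro x
  have hpos : ∀ k : ℕ, (0 : ℝ≥0) < 1 / (k + 1) := fun k => by positivity
  choose ξ hξ e using fun k => h.exists_isometricDefect_op_eq n x (hpos k)
  have hξ0 : Tendsto ξ atTop (𝓝 0) := by
    refine squeeze_zero (fun k => (hξ k).1) (fun k => (hξ k).2) ?_
    simpa using (tendsto_one_div_add_atTop_nhds_zero_nat (𝕜 := ℝ)).const_mul (n : ℝ)
  have hc : Continuous fun t => isometricDefect n (1 + (2 : ℂ) • R) (T.orbit x t) :=
    (continuous_isometricDefect n _).comp (T.continuous_orbit x)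
  have hl := (hc.tendsto 0).comp hξ0
  rw [orbit_zero] at hl
  refine tendsto_nhds_unique hl (tendsto_const_nhds.congr fun k => ?_)
  have h1 := e k
  rw [(isMIsometry_iff_isometricDefect _ _).1 (hT _ (hpos k)), eq_comm, mul_eq_zero] at h1
  have h2 : (((1 / (k + 1) : ℝ≥0) : ℝ) / 2) ^ n ≠ 0 :=
    pow_ne_zero _ (div_ne_zero (NNReal.coe_pos.2 (hpos k)).ne' two_ne_zero)
  exact (h1.resolve_left h2).symm

/-- If the cogenerator is an `(n + 1)`-isometry, its `n`-th defect is constant along orbits starting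
in `D(A)`, and this constant vanishes as soon as a single `T(t)` is an `n`-isometry. -/
theorem IsResolventAtOne.isMIsometry_cogenerator_of_succ (h : T.IsResolventAtOne R) {n : ℕ}
    (hV : IsMIsometry (n + 1) (1 + (2 : ℂ) • R)) {t : ℝ≥0} (ht : 0 < t)
    (hT : IsMIsometry n (T.op t)) : IsMIsometry n (1 + (2 : ℂ) • R) := by
  refine .of_denseRange h.denseRange fun x => ?_
  obtain ⟨ξ, hξ, e⟩ := h.exists_isometricDefect_op_eq n (R x) ht
  have hc : Continuous fun s => isometricDefect n (1 + (2 : ℂ) • R) (T.orbit (R x) s) :=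
    (continuous_isometricDefect n _).comp (T.continuous_orbit _)
  have hconst := constant_of_has_deriv_right_zero (a := 0) (b := ξ) hc.continuousOn
    (fun s hs => by
      simpa [(isMIsometry_iff_isometricDefect _ _).1 hV] using
        h.hasDerivWithinAt_isometricDefect n x hs.1) ξ ⟨hξ.1, le_rfl⟩
  rw [(isMIsometry_iff_isometricDefect _ _).1 hT, hconst, orbit_zero, eq_comm, mul_eq_zero] at e
  exact e.resolve_left (pow_ne_zero _ (div_ne_zero (NNReal.coe_pos.2 ht).ne' two_ne_zero))

theorem exists_isResolventAtOne_of_isMIsometry {m : ℕ} (hT : IsMIsometry m (T.op 1)) :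
    ∃ R, T.IsResolventAtOne R := by
  obtain ⟨n, hn⟩ := hT.exists_norm_pow_lt (Real.one_lt_exp_iff.2 one_pos)
  refine exists_isResolventAtOne (τ := n • 1) ?_
  rw [op_nsmul]
  simpa [← Real.exp_nat_mul] using hn

end Cogenerator

end C0Semigroup

theorem mainTheorem9 {H : Type*} [NormedAddCommGroup H] [InnerProductSpace ℂ H]
    [CompleteSpace H] [TopologicalSpace.SeparableSpace H]
    (m : ℕ) (hm : 1 ≤ m) (T : C0Semigroup H) :
    (∀ t : ℝ≥0, 0 < t → IsStrictMIsometry m (T.op t)) ↔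
      ∃ V : H →L[ℂ] H, T.IsCogenerator V ∧ IsStrictMIsometry m V := by
  obtain ⟨n, rfl⟩ : ∃ n, m = n + 1 := ⟨m - 1, by omega⟩
  constructor
  · intro h
    obtain ⟨R, hR⟩ := C0Semigroup.exists_isResolventAtOne_of_isMIsometry (h 1 one_pos).1
    refine ⟨_, hR.isCogenerator_iff.2 rfl,
      hR.isMIsometry_cogenerator fun t ht => (h t ht).1, fun hV => ?_⟩
    exact (h 1 one_pos).2 (hR.isMIsometry_op hV one_pos)
  · rintro ⟨V, hV, hm, hs⟩ t ht
    obtain ⟨R, hR⟩ := C0Semigroup.one_mem_unboundedResolventSet_iff.1 hV.1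
    rw [hR.isCogenerator_iff] at hV
    subst hV
    exact ⟨hR.isMIsometry_op hm ht, fun hT =>
      hs (hR.isMIsometry_cogenerator_of_succ hm ht hT)⟩
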